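/- **Conventions.** Simplicial complexes and hypergraphs are finite, and $[m]=\{1,\dots,m\}$ (so $[0]=\emptyset$). A *simplex* is a simplicial complex with exactly one facet. For a simplicial complex $\Delta$, $\Delta^{(s)}=\{F\in\Delta : |F|-1\le s\}$ is its $s$-th skeleton, and $\mathcal H(\Delta)$ is the hypergraph whose vertices are those of $\Delta$ and whose edges are the facets of $\Delta$. A vertex $x$ of $\Delta$ is *shedding* if every face of $\mathrm{link}_\Delta(x)=\{G\in\Delta: x\notin G,\ G\cup\{x\}\in\Delta\}$ is properly contained in a face of $\mathrm{del}_\Delta(x)=\{G\in\Delta: x\notin G\}$. The complex $\Delta$ is *vertex decomposable* if it is a simplex or has a shedding vertex $x$ such that $\mathrm{del}_\Delta(x)$ and $\mathrm{link}_\Delta(x)$ are vertex decomposable. A hypergraph is *vertex decomposable* if its independence complex (the complex of all vertex sets containing no edge) is. For a vertex $x$ of a hypergraph $\mathcal H$ with edge set $\mathcal E$, both $\mathcal H\setminus x$ and $\mathcal H/x$ have vertex set $V(\mathcal H)\setminus\{x\}$; the edges of the deletion $\mathcal H\setminus x$ are the $E\in\mathcal E$ with $x\notin E$ (there may be none), and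 the edges of the contraction $\mathcal H/x$ are the sets $E\setminus\{x\}$ with $x\in E\in\mathcal E$, together with those $E\in\mathcal E$ such that $x\notin E$ and $F\setminus\{x\}\not\subseteq E$ for all $F\in\mathcal E\setminus\{E\}$. Put $\mathcal H\setminus(y_1,\dots,y_p)=((\mathcal H\setminus y_1)\cdots)\setminus y_p$. If $\mathcal H$ is a hypergraph with vertices $x_1,\dots,x_n$ and $\ell\ge1$, then $\mathcal H(\ell)$ is the hypergraph with vertices $x_{j,f}$, where $x_j$ lies in some edge of $\mathcal H$ and $f\in[\ell]$, and with edges $\{x_{j_1,f_1},\dots,x_{j_a,f_a}\}$, where $\{x_{j_1},\dots,x_{j_a}\}$ is an edge of $\mathcal H$ with $a$ elements, $f_1,\dots,f_a\in[\ell]$ and $f_1+\dots+f_a\le \ell+a-1$. **Theorem.** Let $\Gamma$ be a simplex with vertex set $\{x_1,\dots,x_n\}$ ($n$ distinct vertices), let $s\in[n-1]$, $\mathcal H=\mathcal H(\Gamma^{(s)})$, and let $\ell\ge1$ be an integer. Then 1. $\mathcal H(\ell)/x_{1,1}$ is vertex decomposable; 2. $\bigl(\mathcal H(\ell)\setminus(x_{1,1},\dots,x_{1,\nu})\bigr)/x_{1,\nu+1}$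 is vertex decomposable for every $\nu\in[\ell-1]$; 3. $\mathcal H(\ell)\setminus(x_{1,1},\dots,x_{1,\ell})$ is vertex decomposable. -/

import Mathlib

/-- A finite abstract simplicial complex: a finite family of finite sets closed under taking
subsets. The empty set is a face as soon as there is any face. -/
structure SimplComplex (α : Type*) where
  faces : Finset (Finset α)
  down_closed : ∀ F ∈ faces, ∀ G ⊆ F, G ∈ faces

namespace SimplComplex

variable {α : Type*} [DecidableEq α]

/-- The vertex set of a complex: the union of its faces. -/
def vertexSet (Δ : SimplComplex α) : Finset α := Δ.faces.biUnion id

/-- Facets are the inclusion-maximal faces. -/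
def IsFacet (Δ : SimplComplex α) (F : Finset α) : Prop :=
  F ∈ Δ.faces ∧ ∀ G ∈ Δ.faces, F ⊆ G → G = F

/-- A simplex is a simplicial complex with exactly one facet. -/
def IsSimplex (Δ : SimplComplex α) : Prop := ∃! F, Δ.IsFacet F

/-- The `s`-th skeleton: the faces of dimension `|F| - 1 ≤ s`. -/
def skeleton (Δ : SimplComplex α) (s : ℕ) : SimplComplex α where
  faces := Δ.faces.filter fun F => F.card ≤ s + 1
  down_closed := by
    intro F hF G hG
    rw [Finset.mem_filter] at hF ⊢
    exact ⟨Δ.down_closed F hF.1 G hG, (Finset.card_le_card hG).trans hF.2⟩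

/-- The deletion of a vertex. -/
def del (Δ : SimplComplex α) (x : α) : SimplComplex α where
  faces := Δ.faces.filter fun G => x ∉ G
  down_closed := by
    intro F hF G hG
    rw [Finset.mem_filter] at hF ⊢
    exact ⟨Δ.down_closed F hF.1 G hG, fun h => hF.2 (hG h)⟩

/-- The link of a vertex. -/
def link (Δ : SimplComplex α) (x : α) : SimplComplex α where
  faces := Δ.faces.filter fun G => x ∉ G ∧ insert x G ∈ Δ.faces
  down_closed := by
    intro F hF G hG
    rw [Finset.mem_filter] at hF ⊢
    exact ⟨Δ.down_closed F hF.1 G hG, fun h => hF.2.1 (hG h),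
      Δ.down_closed _ hF.2.2 _ (Finset.insert_subset_insert x hG)⟩

/-- A vertex `x` is shedding if every face of its link is properly contained in a face of its
deletion. -/
def IsSheddingVertex (Δ : SimplComplex α) (x : α) : Prop :=
  x ∈ Δ.vertexSet ∧ ∀ F ∈ (Δ.link x).faces, ∃ F' ∈ (Δ.del x).faces, F ⊂ F'

/-- Vertex decomposability (non-pure sense). -/
inductive IsVertexDecomposable : SimplComplex α → Prop
  | simplex (Δ : SimplComplex α) (h : Δ.IsSimplex) : IsVertexDecomposable Δ
  | shed (Δ : SimplComplex α) (x : α) (hx : Δ.IsSheddingVertex x)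
      (hdel : IsVertexDecomposable (Δ.del x)) (hlink : IsVertexDecomposable (Δ.link x)) :
      IsVertexDecomposable Δ

end SimplComplex

/-- A hypergraph on a finite vertex set. The edge set may be empty, since deletions of vertices
can destroy all edges. -/
structure VHypergraph (α : Type*) where
  verts : Finset α
  edges : Set (Finset α)
  edges_subset : ∀ E ∈ edges, E ⊆ verts

/-- The hypergraph of a simplicial complex; its edges are the facets. -/
def SimplComplex.toHypergraph {α : Type*} [DecidableEq α] (Δ : SimplComplex α) :
    VHypergraph α where
  verts := Δ.vertexSet
  edges := {F | Δ.IsFacet F}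
  edges_subset := fun F hF _ hx => Finset.mem_biUnion.2 ⟨F, hF.1, hx⟩

namespace VHypergraph

variable {α : Type*} [DecidableEq α]

/-- A set of vertices is independent if it contains no edge. -/
def IsIndependent (H : VHypergraph α) (S : Finset α) : Prop :=
  S ⊆ H.verts ∧ ∀ E ∈ H.edges, ¬ E ⊆ S

open Classical in
/-- The independence complex. Its faces are the independent sets, so its facets are the maximal
independent sets and, the vertex set being finite, these generate it. -/
noncomputable def independenceComplex (H : VHypergraph α) : SimplComplex α where
  faces := H.verts.powerset.filter fun S => H.IsIndependent S
  down_closed := by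
    intro F hF G hG
    rw [Finset.mem_filter, Finset.mem_powerset] at hF ⊢
    exact ⟨hG.trans hF.1, hG.trans hF.1, fun E hE h => hF.2.2 E hE (h.trans hG)⟩

/-- A hypergraph is vertex decomposable if its independence complex is. -/
def IsVertexDecomposable (H : VHypergraph α) : Prop :=
  H.independenceComplex.IsVertexDecomposable

/-- The contraction `H / x`. -/
def contract (H : VHypergraph α) (x : α) : VHypergraph α where
  verts := H.verts.erase x
  edges := {E' | ∃ E ∈ H.edges, x ∈ E ∧ E' = E.erase x} ∪
    {E | E ∈ H.edges ∧ x ∉ E ∧ ∀ F ∈ H.edges, F ≠ E → ¬ F.erase x ⊆ E}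
  edges_subset := by
    rintro E (⟨F, hF, -, rfl⟩ | ⟨hE, hx, -⟩)
    · exact Finset.erase_subset_erase x (H.edges_subset F hF)
    · exact Finset.subset_erase.2 ⟨H.edges_subset E hE, hx⟩

/-- The deletion `H \ x`. -/
def delete (H : VHypergraph α) (x : α) : VHypergraph α where
  verts := H.verts.erase x
  edges := {E | E ∈ H.edges ∧ x ∉ E}
  edges_subset := fun E hE => Finset.subset_erase.2 ⟨H.edges_subset E hE.1, hE.2⟩

/-- The iterated deletion `H \ (y₁, …, yₚ) = ((H \ y₁) ⋯) \ yₚ`. -/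
def deleteList (H : VHypergraph α) (L : List α) : VHypergraph α :=
  L.foldl (fun K y => K.delete y) H

open Classical in
/-- The hypergraph `H(ℓ)`, for `ℓ ≥ 1`. The pair `(x, f)` stands for the copy `x_f` of the vertex
`x`. The vertices are the `x_f` with `x` in some edge and `1 ≤ f ≤ ℓ`; each edge `F` of `H` gives
the edges `{x_{f(x)} : x ∈ F}` with `1 ≤ f(x) ≤ ℓ` and `∑ f(x) ≤ ℓ + |F| - 1`. -/
noncomputable def expand (H : VHypergraph α) (ℓ : ℕ) : VHypergraph (α × ℕ) where
  verts := (H.verts.filter fun x => ∃ F ∈ H.edges, x ∈ F) ×ˢ Finset.Icc 1 ℓ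
  edges := {E | ∃ F ∈ H.edges, ∃ f : α → ℕ, (∀ x ∈ F, f x ∈ Finset.Icc 1 ℓ) ∧
    ∑ x ∈ F, f x ≤ ℓ + F.card - 1 ∧ E = F.image fun x => (x, f x)}
  edges_subset := by
    rintro E ⟨F, hF, f, hf, -, rfl⟩ p hp
    obtain ⟨x, hx, rfl⟩ := Finset.mem_image.1 hp
    exact Finset.mem_product.2
      ⟨Finset.mem_filter.2 ⟨H.edges_subset F hF hx, F, hF, hx⟩, hf x hx⟩

end VHypergraph

/-- The sequence of copies `x_1, …, x_ν` of the vertex `x`. -/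
def vertexCopies {α : Type*} (x : α) (ν : ℕ) : List (α × ℕ) :=
  (List.range ν).map fun k => (x, k + 1)

/-! ### Faces of deletions and links; facets of skeleta of a simplex. -/

namespace SimplComplex

variable {α : Type*} [DecidableEq α]

/-! The edges of the hypergraph are all `d`-subsets of `V`, where `d = s + 1`. A set `S` of copies
matters only through its lowest copy over each `x`: with `c x` one less than that height (`ℓ` if
there is none), `S` contains an edge iff `c` sums to less than `ℓ` on some `d`-subset. So
independent sets are those lying strictly above some covering function (`isIndependent_expand_iff`).

Since edges have equal size, contraction is a link, and each of the three hypergraphs amounts to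
fixing the value of `c` at `x₁`: at `ν` for the contractions, at `ℓ` once all copies are deleted.

Complexes of this kind, with some coordinates fixed and the others bounded below, are closed under
deleting or linking the lowest copy over a free coordinate: deletion raises a bound, linking fixes a
coordinate. Choosing a coordinate with the least bound makes that copy shedding, because covering
functions stay covering when a unit moves from a larger value to a smaller one
(`swap_mem_coveringFunctions`). -/

theorem ext_faces {β : Type*} {Δ Δ' : SimplComplex β} (h : ∀ S, S ∈ Δ.faces ↔ S ∈ Δ'.faces) :
    Δ = Δ' := by
  cases Δ; cases Δ'
  congr 1
  exact Finset.ext h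

theorem mem_del {Δ : SimplComplex α} {x : α} {S : Finset α} :
    S ∈ (Δ.del x).faces ↔ S ∈ Δ.faces ∧ x ∉ S := by
  simp [del]

theorem mem_link {Δ : SimplComplex α} {x : α} {S : Finset α} :
    S ∈ (Δ.link x).faces ↔ x ∉ S ∧ insert x S ∈ Δ.faces := by
  simp only [link, Finset.mem_filter, and_iff_right_iff_imp]
  exact fun h => Δ.down_closed _ h.2 _ (Finset.subset_insert x S)

theorem isSimplex_of_mem_iff {β : Type*} {Δ : SimplComplex β} {G : Finset β}
    (h : ∀ S, S ∈ Δ.faces ↔ S ⊆ G) : Δ.IsSimplex := by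
  refine ⟨G, ⟨(h G).2 subset_rfl, fun S hS hGS => ((h S).1 hS).antisymm hGS⟩, ?_⟩
  exact fun F hF => (hF.2 G ((h G).2 subset_rfl) ((h F).1 hF.1)).symm

theorem exists_isFacet_superset {β : Type*} (Δ : SimplComplex β) {F : Finset β}
    (hF : F ∈ Δ.faces) : ∃ G, Δ.IsFacet G ∧ F ⊆ G := by
  obtain ⟨G, hFG, hG⟩ := Δ.faces.exists_le_maximal hF
  exact ⟨G, ⟨hG.1, fun K hK hGK => (hG.2 hK hGK).antisymm hGK⟩, hFG⟩

theorem IsSimplex.mem_faces_iff {Δ : SimplComplex α} (h : Δ.IsSimplex) {S : Finset α} :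
    S ∈ Δ.faces ↔ S ⊆ Δ.vertexSet := by
  obtain ⟨F, hF, huniq⟩ := h
  have hle : ∀ K ∈ Δ.faces, K ⊆ F := fun K hK => by
    obtain ⟨G, hG, hKG⟩ := Δ.exists_isFacet_superset hK
    exact huniq G hG ▸ hKG
  refine ⟨fun hS => Finset.subset_biUnion_of_mem id hS, fun hS => Δ.down_closed F hF.1 S ?_⟩
  exact hS.trans (Finset.biUnion_subset.2 hle)

theorem IsSimplex.isFacet_skeleton_iff {Δ : SimplComplex α} (h : Δ.IsSimplex) {s : ℕ}
    (hs : s + 1 ≤ Δ.vertexSet.card) {F : Finset α} :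
    (Δ.skeleton s).IsFacet F ↔ F ⊆ Δ.vertexSet ∧ F.card = s + 1 := by
  have hmem : ∀ S, S ∈ (Δ.skeleton s).faces ↔ S ⊆ Δ.vertexSet ∧ S.card ≤ s + 1 := fun S => by
    simp [skeleton, h.mem_faces_iff]
  constructor
  · rintro ⟨hF, hmax⟩
    rw [hmem] at hF
    obtain ⟨G, hFG, hGV, hG⟩ := Finset.exists_subsuperset_card_eq hF.1 hF.2 hs
    have := hmax G ((hmem G).2 ⟨hGV, hG.le⟩) hFG
    exact ⟨hF.1, this ▸ hG⟩
  · rintro ⟨hFV, hF⟩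
    refine ⟨(hmem F).2 ⟨hFV, hF.le⟩, fun G hG hFG => ?_⟩
    exact (Finset.eq_of_subset_of_card_le hFG (hF ▸ ((hmem G).1 hG).2)).symm

end SimplComplex

/-! ### Threshold complexes and covering functions. -/

section ThresholdComplex

variable {α : Type*} [DecidableEq α]

/-- The sets `S ⊆ G` lying strictly above some `c ∈ C` with `a ≤ c`, and `c = a` outside `U`. -/
def IsThresholdFace (C : Set (α → ℕ)) (U : Finset α) (a : α → ℕ) (G S : Finset (α × ℕ)) : Prop :=
  S ⊆ G ∧ ∃ c ∈ C, (∀ x ∉ U, c x = a x) ∧ (∀ x, a x ≤ c x) ∧ ∀ p ∈ S, c p.1 < p.2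

/-- Induction on the size of `G`. Only closure of `C` under raising (`hup`) and under unit transfers
(`hswap`) is needed; `hfull` ensures that the vertices to be removed or added really are in `G`. -/
theorem isVertexDecomposable_of_isThresholdFace (C : Set (α → ℕ)) (V : Finset α) (ℓ : ℕ)
    (hbdd : ∀ c ∈ C, ∀ x, c x ≤ ℓ)
    (hup : ∀ c ∈ C, ∀ x, c x < ℓ → Function.update c x (c x + 1) ∈ C)
    (hswap : ∀ c ∈ C, ∀ x ∈ V, ∀ y ∈ V, c x < c y →
      Function.update (Function.update c x (c x + 1)) y (c y - 1) ∈ C)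
    (G : Finset (α × ℕ)) (U : Finset α) (hUV : U ⊆ V) (a : α → ℕ)
    (hlow : ∀ p ∈ G, a p.1 < p.2) (hle : ∀ p ∈ G, p.2 ≤ ℓ)
    (hfull : ∀ x ∈ U, ∀ f, a x < f → f ≤ ℓ → (x, f) ∈ G)
    (Δ : SimplComplex (α × ℕ)) (hΔ : ∀ S, S ∈ Δ.faces ↔ IsThresholdFace C U a G S)
    (hne : Δ.faces.Nonempty) : Δ.IsVertexDecomposable := by
  induction hn : G.card using Nat.strong_induction_on generalizing G U a Δ with
  | _ n ih =>
  subst hn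
  by_cases haC : a ∈ C
  · refine .simplex _ (SimplComplex.isSimplex_of_mem_iff (G := G) fun S => ?_)
    rw [hΔ]
    exact ⟨And.left, fun h => ⟨h, a, haC, fun _ _ => rfl, fun _ => le_rfl,
      fun p hp => hlow p (h hp)⟩⟩
  by_cases hU : ∀ p ∈ G, p.1 ∉ U
  · refine .simplex _ (SimplComplex.isSimplex_of_mem_iff (G := G) fun S => ?_)
    rw [hΔ]
    obtain ⟨S₀, hS₀⟩ := hne
    obtain ⟨-, c, hc, hcU, hac, -⟩ := (hΔ S₀).1 hS₀
    exact ⟨And.left, fun h => ⟨h, c, hc, hcU, hac, fun p hp =>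
      hcU _ (hU p (h hp)) ▸ hlow p (h hp)⟩⟩
  push Not at hU
  obtain ⟨p₀, hp₀G, hp₀U⟩ := hU
  -- Minimality of `a x` is what later gives `c x < c y` for the unit transfer.
  obtain ⟨x, hxU, hxmin⟩ := U.exists_min_image a ⟨_, hp₀U⟩
  have hxℓ : a x < ℓ := (hxmin _ hp₀U).trans_lt ((hlow _ hp₀G).trans_le (hle _ hp₀G))
  have hxG : (x, a x + 1) ∈ G := hfull x hxU _ (Nat.lt_succ_self _) hxℓ
  have hcard : (G.erase (x, a x + 1)).card < G.card := Finset.card_erase_lt_of_mem hxG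
  have hdelFace : ∀ S, S ∈ (Δ.del (x, a x + 1)).faces ↔
      IsThresholdFace C U (Function.update a x (a x + 1)) (G.erase (x, a x + 1)) S := by
    intro S
    rw [SimplComplex.mem_del, hΔ]
    constructor
    · rintro ⟨⟨hSG, c, hc, hcU, hac, hcS⟩, hxS⟩
      refine ⟨Finset.subset_erase.2 ⟨hSG, hxS⟩, ?_⟩
      rcases (hac x).lt_or_eq with hlt | heq
      · refine ⟨c, hc, fun y hy => ?_, fun y => ?_, hcS⟩
        · rw [Function.update_of_ne (by rintro rfl; exact hy hxU), hcU y hy]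
        · rcases eq_or_ne y x with rfl | hyx
          · simpa using hlt
          · simpa [hyx] using hac y
      -- As `S` avoids `(x, a x + 1)`, the value `c x = a x` can be raised by one with `S` still
      -- strictly above.
      · refine ⟨_, hup c hc x (heq ▸ hxℓ), fun y hy => ?_, fun y => ?_, fun p hp => ?_⟩
        · have hyx : y ≠ x := by rintro rfl; exact hy hxU
          simpa [hyx] using hcU y hy
        · rcases eq_or_ne y x with rfl | hyx
          · simp [heq]
          · simpa [hyx] using hac y
        · obtain ⟨y, f⟩ := p
          have h1 := hcS _ hp
          rcases eq_or_ne y x with rfl | hyx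
          · have : f ≠ a y + 1 := by rintro rfl; exact hxS hp
            simp only [Function.update_self] at h1 ⊢
            omega
          · simpa [hyx] using h1
    · rintro ⟨hSG, c, hc, hcU, hac, hcS⟩
      obtain ⟨hSG, hxS⟩ := Finset.subset_erase.1 hSG
      refine ⟨⟨hSG, c, hc, fun y hy => ?_, fun y => ?_, hcS⟩, hxS⟩
      · rw [hcU y hy, Function.update_of_ne (by rintro rfl; exact hy hxU)]
      · refine le_trans ?_ (hac y)
        rcases eq_or_ne y x with rfl | hyx <;> simp [*]
  have hlinkFace : ∀ S, S ∈ (Δ.link (x, a x + 1)).faces ↔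
      IsThresholdFace C (U.erase x) a (G.erase (x, a x + 1)) S := by
    intro S
    rw [SimplComplex.mem_link, hΔ]
    constructor
    · rintro ⟨hxS, hSG, c, hc, hcU, hac, hcS⟩
      refine ⟨Finset.subset_erase.2 ⟨(Finset.subset_insert _ _).trans hSG, hxS⟩, c, hc,
        fun y hy => ?_, hac, fun p hp => hcS p (Finset.mem_insert_of_mem hp)⟩
      by_cases hyU : y ∈ U
      · obtain rfl : y = x := by by_contra h; exact hy (Finset.mem_erase.2 ⟨h, hyU⟩)
        exact le_antisymm (Nat.lt_succ_iff.1 (hcS _ (Finset.mem_insert_self _ _))) (hac y)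
      · exact hcU y hyU
    · rintro ⟨hSG, c, hc, hcU, hac, hcS⟩
      obtain ⟨hSG, hxS⟩ := Finset.subset_erase.1 hSG
      refine ⟨hxS, Finset.insert_subset hxG hSG, c, hc,
        fun y hy => hcU y fun h => hy (Finset.mem_of_mem_erase h), hac, fun p hp => ?_⟩
      rcases Finset.mem_insert.1 hp with rfl | hp
      · exact Nat.lt_succ_iff.2 (hcU x (by simp)).le
      · exact hcS p hp
  have hdel : (Δ.del (x, a x + 1)).IsVertexDecomposable := by
    refine ih _ hcard _ U hUV _ (fun p hp => ?_) (fun p hp => hle p (Finset.mem_of_mem_erase hp))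
      (fun y hy f hf hfℓ => ?_) _ hdelFace ?_ rfl
    · obtain ⟨y, f⟩ := p
      obtain ⟨hne, hp⟩ := Finset.mem_erase.1 hp
      have h1 := hlow _ hp
      rcases eq_or_ne y x with rfl | hyx
      · have : f ≠ a y + 1 := by rintro rfl; exact hne rfl
        simp only [Function.update_self] at h1 ⊢
        omega
      · simpa [hyx] using h1
    · rcases eq_or_ne y x with rfl | hyx
      · simp only [Function.update_self] at hf
        refine Finset.mem_erase.2 ⟨fun h => ?_, hfull y hy f (by omega) hfℓ⟩
        have := (Prod.ext_iff.1 h).2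
        simp only at this
        omega
      · rw [Function.update_of_ne hyx] at hf
        exact Finset.mem_erase.2 ⟨fun h => hyx (Prod.ext_iff.1 h).1, hfull y hy f hf hfℓ⟩
    · obtain ⟨S, hS⟩ := hne
      exact ⟨∅, SimplComplex.mem_del.2 ⟨Δ.down_closed S hS _ (Finset.empty_subset _), by simp⟩⟩
  by_cases hlne : (Δ.link (x, a x + 1)).faces.Nonempty
  · refine .shed _ (x, a x + 1) ⟨?_, fun S hS => ?_⟩ hdel ?_
    · obtain ⟨S, hS⟩ := hlne
      exact Finset.mem_biUnion.2 ⟨_, (SimplComplex.mem_link.1 hS).2, Finset.mem_insert_self _ _⟩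
    · obtain ⟨hSG, c, hc, hcU, hac, hcS⟩ := (hlinkFace S).1 hS
      have hcx : c x = a x := hcU x (by simp)
      -- Since `a ∉ C`, the function `c` exceeds `a` at some free `y`. Adding `(y, c y)` to `S`
      -- costs one unit at `y`, which is moved to `x`.
      obtain ⟨y, hy⟩ : ∃ y, a y < c y := by
        by_contra! h
        exact haC ((funext fun y => (h y).antisymm (hac y)) ▸ hc)
      have hyU : y ∈ U.erase x := by
        by_contra h
        exact hy.ne (hcU y h).symm
      obtain ⟨hyx, hyU⟩ := Finset.mem_erase.1 hyU
      have hyxne : (y, c y) ≠ (x, a x + 1) := fun h => hyx (Prod.ext_iff.1 h).1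
      have hyS : (y, c y) ∉ S := fun h => lt_irrefl _ (hcS _ h)
      obtain ⟨-, hxS⟩ := Finset.subset_erase.1 hSG
      refine ⟨insert (y, c y) S, (hdelFace _).2 ⟨Finset.insert_subset
        (Finset.mem_erase.2 ⟨hyxne, hfull y hyU _ hy (hbdd c hc y)⟩) hSG, _,
        hswap c hc x (hUV hxU) y (hUV hyU)
          (hcx.trans_lt ((hxmin y hyU).trans_lt hy)), fun z hz => ?_, fun z => ?_, ?_⟩,
        Finset.ssubset_insert hyS⟩
      · have hzx : z ≠ x := by rintro rfl; exact hz hxU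
        have hzy : z ≠ y := by rintro rfl; exact hz hyU
        simpa [hzx, hzy] using hcU z (fun h => hz (Finset.mem_of_mem_erase h))
      · rcases eq_or_ne z y with rfl | hzy
        · simp only [Function.update_self, Function.update_of_ne hyx]
          omega
        rcases eq_or_ne z x with rfl | hzx
        · simp [hzy, hcx]
        · simpa [hzy, hzx] using hac z
      · rintro ⟨z, f⟩ hp
        rcases Finset.mem_insert.1 hp with h | hp
        · rw [h]
          simp only [Function.update_self]
          omega
        · have h1 := hcS _ hp
          simp only at h1 ⊢
          rcases eq_or_ne z y with rfl | hzy
          · simp only [Function.update_self]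
            omega
          rcases eq_or_ne z x with rfl | hzx
          · have : f ≠ a z + 1 := by rintro rfl; exact hxS hp
            simp only [Function.update_of_ne hzy, Function.update_self]
            omega
          · simpa [hzy, hzx] using h1
    · refine ih _ hcard _ (U.erase x) ((Finset.erase_subset _ _).trans hUV) a
        (fun p hp => hlow p (Finset.mem_of_mem_erase hp))
        (fun p hp => hle p (Finset.mem_of_mem_erase hp)) (fun y hy f hf hfℓ => ?_) _ hlinkFace
        hlne rfl
      obtain ⟨hyx, hyU⟩ := Finset.mem_erase.1 hy
      exact Finset.mem_erase.2 ⟨fun h => hyx (Prod.ext_iff.1 h).1, hfull y hyU f hf hfℓ⟩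
  -- A void complex has no facet, hence is not vertex decomposable; but if the link is void, no face
  -- contains the chosen vertex and `Δ` is its own deletion.
  · convert hdel using 1
    refine SimplComplex.ext_faces fun S => ?_
    rw [SimplComplex.mem_del]
    refine ⟨fun hS => ⟨hS, fun hxS => hlne ⟨S.erase (x, a x + 1), ?_⟩⟩, And.left⟩
    rw [SimplComplex.mem_link, Finset.insert_erase hxS]
    exact ⟨by simp, hS⟩

/-- The functions bounded by `ℓ` whose sum over every `d`-subset of `V` is at least `ℓ`. -/
def coveringFunctions (V : Finset α) (d ℓ : ℕ) : Set (α → ℕ) :=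
  {c | (∀ x, c x ≤ ℓ) ∧ ∀ F ⊆ V, F.card = d → ℓ ≤ ∑ x ∈ F, c x}

theorem mem_coveringFunctions_of_le {β : Type*} {V : Finset β} {d ℓ : ℕ} {c c' : β → ℕ}
    (hc : c ∈ coveringFunctions V d ℓ) (hle : ∀ x ∈ V, c x ≤ c' x) (hbdd : ∀ x, c' x ≤ ℓ) :
    c' ∈ coveringFunctions V d ℓ :=
  ⟨hbdd, fun F hFV hF => (hc.2 F hFV hF).trans (Finset.sum_le_sum fun x hx => hle x (hFV hx))⟩

theorem update_mem_coveringFunctions {V : Finset α} {d ℓ : ℕ} {c : α → ℕ}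
    (hc : c ∈ coveringFunctions V d ℓ) {x : α} (hx : c x < ℓ) :
    Function.update c x (c x + 1) ∈ coveringFunctions V d ℓ := by
  refine mem_coveringFunctions_of_le hc (fun y _ => ?_) (fun y => ?_)
  · rcases eq_or_ne y x with rfl | h <;> simp [*]
  · rcases eq_or_ne y x with rfl | h
    · simpa using hx
    · simpa [h] using hc.1 y

/-- Only a `d`-set containing `y` but not `x` loses weight. Exchanging `y` for `x` in it gives
another `d`-set, of old weight at least `ℓ`, and `c x ≤ c y - 1`. -/
theorem swap_mem_coveringFunctions {V : Finset α} {d ℓ : ℕ} {c : α → ℕ}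
    (hc : c ∈ coveringFunctions V d ℓ) {x y : α} (hx : x ∈ V) (hxy : c x < c y) :
    Function.update (Function.update c x (c x + 1)) y (c y - 1) ∈ coveringFunctions V d ℓ := by
  have hne : y ≠ x := by rintro rfl; exact lt_irrefl _ hxy
  have hval : ∀ z, Function.update (Function.update c x (c x + 1)) y (c y - 1) z =
      if z = y then c y - 1 else if z = x then c x + 1 else c z := fun z => by
    simp only [Function.update_apply]
  refine ⟨fun z => ?_, fun F hFV hF => ?_⟩
  · have h1 := hc.1 y
    have h2 := hc.1 z
    rw [hval]
    split_ifs <;> omega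
  simp only [hval]
  by_cases hyF : y ∈ F
  · rw [← Finset.add_sum_erase _ _ hyF, if_pos rfl]
    by_cases hxF : x ∈ F
    · have hxF' : x ∈ F.erase y := Finset.mem_erase.2 ⟨hne.symm, hxF⟩
      rw [← Finset.add_sum_erase _ _ hxF', if_neg hne.symm, if_pos rfl]
      have hsum := hc.2 F hFV hF
      rw [← Finset.add_sum_erase _ _ hyF, ← Finset.add_sum_erase _ _ hxF'] at hsum
      have : ∑ z ∈ (F.erase y).erase x, c z = ∑ z ∈ (F.erase y).erase x,
          if z = y then c y - 1 else if z = x then c x + 1 else c z := by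
        refine Finset.sum_congr rfl fun z hz => ?_
        rw [if_neg (Finset.ne_of_mem_erase (Finset.mem_of_mem_erase hz)),
          if_neg (Finset.ne_of_mem_erase hz)]
      omega
    · have hxF' : x ∉ F.erase y := fun h => hxF (Finset.mem_of_mem_erase h)
      have hsum := hc.2 (insert x (F.erase y))
        (Finset.insert_subset hx ((Finset.erase_subset _ _).trans hFV))
        (by rw [Finset.card_insert_of_notMem hxF', Finset.card_erase_add_one hyF, hF])
      rw [Finset.sum_insert hxF'] at hsum
      have : ∑ z ∈ F.erase y, c z = ∑ z ∈ F.erase y,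
          if z = y then c y - 1 else if z = x then c x + 1 else c z := by
        refine Finset.sum_congr rfl fun z hz => ?_
        rw [if_neg (Finset.ne_of_mem_erase hz), if_neg (by rintro rfl; exact hxF' hz)]
      omega
  · refine (hc.2 F hFV hF).trans (Finset.sum_le_sum fun z hz => ?_)
    rw [if_neg (by rintro rfl; exact hyF hz)]
    split_ifs with h
    · rw [h]; omega
    · exact le_rfl

end ThresholdComplex

/-! ### Independent sets of deletions, contractions and expansions. -/

namespace VHypergraph

variable {α : Type*} [DecidableEq α]

theorem mem_independenceComplex {β : Type*} {H : VHypergraph β} {S : Finset β} :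
    S ∈ H.independenceComplex.faces ↔ H.IsIndependent S := by
  simp only [independenceComplex, Finset.mem_filter, Finset.mem_powerset, and_iff_right_iff_imp]
  exact And.left

theorem mem_verts_deleteList {L : List α} {H : VHypergraph α} {x : α} :
    x ∈ (H.deleteList L).verts ↔ x ∈ H.verts ∧ x ∉ L := by
  induction L generalizing H with
  | nil => simp [deleteList]
  | cons y L ih =>
    have := ih (H := H.delete y)
    simp only [deleteList, List.foldl_cons] at this ⊢
    rw [this]
    simp only [delete, Finset.mem_erase, List.mem_cons]
    tauto

theorem mem_edges_deleteList {L : List α} {H : VHypergraph α} {E : Finset α} :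
    E ∈ (H.deleteList L).edges ↔ E ∈ H.edges ∧ ∀ y ∈ L, y ∉ E := by
  induction L generalizing H with
  | nil => simp [deleteList]
  | cons y L ih =>
    have := ih (H := H.delete y)
    simp only [deleteList, List.foldl_cons] at this ⊢
    rw [this]
    simp only [delete, Set.mem_ofPred_eq, List.forall_mem_cons]
    tauto

theorem isIndependent_deleteList_iff {L : List α} {H : VHypergraph α} {S : Finset α} :
    (H.deleteList L).IsIndependent S ↔ H.IsIndependent S ∧ ∀ y ∈ L, y ∉ S := by
  constructor
  · rintro ⟨hS, hE⟩
    have hL : ∀ y ∈ L, y ∉ S := fun y hy hyS => (mem_verts_deleteList.1 (hS hyS)).2 hy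
    exact ⟨⟨fun x hx => (mem_verts_deleteList.1 (hS hx)).1, fun E hEH hES =>
      hE E (mem_edges_deleteList.2 ⟨hEH, fun y hy hyE => hL y hy (hES hyE)⟩) hES⟩, hL⟩
  · rintro ⟨⟨hS, hE⟩, hL⟩
    exact ⟨fun x hx => mem_verts_deleteList.2 ⟨hS hx, fun h => hL x h hx⟩,
      fun E hEH => hE E (mem_edges_deleteList.1 hEH).1⟩

/-- In a clutter, the independent sets of a contraction are the faces of the link. -/
theorem isIndependent_contract_iff {H : VHypergraph α} {x : α} (hx : x ∈ H.verts)
    (hclutter : ∀ E ∈ H.edges, ∀ F ∈ H.edges, F ⊆ E → F = E) {S : Finset α} :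
    (H.contract x).IsIndependent S ↔ x ∉ S ∧ H.IsIndependent (insert x S) := by
  constructor
  · rintro ⟨hS, hE⟩
    obtain ⟨hSV, hxS⟩ := Finset.subset_erase.1 hS
    refine ⟨hxS, Finset.insert_subset hx hSV, fun E hEH hES => ?_⟩
    have hES' : E.erase x ⊆ S := by
      rw [← Finset.subset_insert_iff]; exact hES
    by_cases hxE : x ∈ E
    · exact hE _ (Or.inl ⟨E, hEH, hxE, rfl⟩) hES'
    rw [Finset.erase_eq_of_notMem hxE] at hES'
    refine hE E (Or.inr ⟨hEH, hxE, fun F hF hFE hsub => ?_⟩) hES'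
    by_cases hxF : x ∈ F
    · exact hE _ (Or.inl ⟨F, hF, hxF, rfl⟩) (hsub.trans hES')
    · rw [Finset.erase_eq_of_notMem hxF] at hsub
      exact hFE (hclutter E hEH F hF hsub)
  · rintro ⟨hxS, hSV, hE⟩
    refine ⟨Finset.subset_erase.2 ⟨(Finset.subset_insert _ _).trans hSV, hxS⟩, ?_⟩
    rintro E (⟨F, hF, -, rfl⟩ | ⟨hEH, -, -⟩) hES
    · exact hE F hF (Finset.subset_insert_iff.2 hES)
    · exact hE E hEH (hES.trans (Finset.subset_insert _ _))

/-- The edges of `H` are the `d`-subsets of `V`. -/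
def IsComplete (H : VHypergraph α) (V : Finset α) (d : ℕ) : Prop :=
  H.verts = V ∧ ∀ F, F ∈ H.edges ↔ F ⊆ V ∧ F.card = d

variable {H : VHypergraph α} {V : Finset α} {d ℓ : ℕ}

theorem IsComplete.verts_expand (h : H.IsComplete V d) (hd : 1 ≤ d) (hdV : d ≤ V.card) :
    (H.expand ℓ).verts = V ×ˢ Finset.Icc 1 ℓ := by
  classical
  have : ∀ x ∈ V, ∃ F ∈ H.edges, x ∈ F := fun x hx => ?_
  · ext p
    simp only [expand, h.1, Finset.mem_product, Finset.mem_filter]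
    exact and_congr_left fun _ => ⟨And.left, fun hp => ⟨hp, this _ hp⟩⟩
  obtain ⟨F, hxF, hFV, hF⟩ := Finset.exists_subsuperset_card_eq
    (Finset.singleton_subset_iff.2 hx) (by simpa using hd) hdV
  exact ⟨F, (h.2 F).2 ⟨hFV, hF⟩, Finset.singleton_subset_iff.1 hxF⟩

theorem IsComplete.card_of_mem_edges_expand (h : H.IsComplete V d) {E : Finset (α × ℕ)}
    (hE : E ∈ (H.expand ℓ).edges) : E.card = d := by
  obtain ⟨F, hF, f, -, -, rfl⟩ := hE
  rw [Finset.card_image_of_injective _ fun x y hxy => (Prod.ext_iff.1 hxy).1]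
  exact ((h.2 F).1 hF).2

theorem IsComplete.isIndependent_expand_iff (h : H.IsComplete V d) (hd : 1 ≤ d)
    (hdV : d ≤ V.card) {S : Finset (α × ℕ)} :
    (H.expand ℓ).IsIndependent S ↔
      S ⊆ V ×ˢ Finset.Icc 1 ℓ ∧ ∃ c ∈ coveringFunctions V d ℓ, ∀ p ∈ S, c p.1 < p.2 := by
  rw [IsIndependent, h.verts_expand hd hdV]
  refine and_congr_right fun hSV => ⟨fun hE => ?_, ?_⟩
  -- The largest candidate for `c`: the lowest height over `x` minus one, with default `ℓ` where `S`
  -- has no copy.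
  · have hmem : ∀ x, sInf ({m | (x, m + 1) ∈ S} ∪ {ℓ}) ∈ ({m | (x, m + 1) ∈ S} ∪ {ℓ} : Set ℕ) :=
      fun x => Nat.sInf_mem ⟨ℓ, Or.inr rfl⟩
    set c : α → ℕ := fun x => sInf ({m | (x, m + 1) ∈ S} ∪ {ℓ}) with hcdef
    have hcℓ : ∀ x, c x ≤ ℓ := fun x => Nat.sInf_le (Or.inr rfl)
    refine ⟨c, ⟨hcℓ, fun F hFV hF => ?_⟩, ?_⟩
    · by_contra! hlt
      have hxlt : ∀ x ∈ F, c x < ℓ := fun x hx =>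
        -- A sum below `ℓ` rules out the default value on `F`, so the lowest copies over `F` exist
        -- and form an edge inside `S`.
        (Finset.single_le_sum (f := c) (fun _ _ => Nat.zero_le _) hx).trans_lt hlt
      refine hE (F.image fun x => (x, c x + 1)) ⟨F, (h.2 F).2 ⟨hFV, hF⟩, fun x => c x + 1,
        fun x hx => ?_, ?_, rfl⟩ ?_
      · exact Finset.mem_Icc.2 ⟨Nat.le_add_left 1 _, hxlt x hx⟩
      · rw [Finset.sum_add_distrib, Finset.sum_const, smul_eq_mul, mul_one]; omega
      · rw [Finset.image_subset_iff]
        exact fun x hx => (hmem x).resolve_right (hxlt x hx).ne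
    · rintro ⟨x, f⟩ hp
      have hf := (Finset.mem_Icc.1 (Finset.mem_product.1 (hSV hp)).2).1
      simp only at hf ⊢
      obtain ⟨m, rfl⟩ : ∃ m, f = m + 1 := ⟨f - 1, by omega⟩
      exact Nat.lt_succ_iff.2 (Nat.sInf_le (Or.inl hp))
  · rintro ⟨c, hc, hcS⟩ E ⟨F, hF, f, -, hsum, rfl⟩ hES
    obtain ⟨hFV, hFd⟩ := (h.2 F).1 hF
    have h1 : ∑ x ∈ F, (c x + 1) ≤ ∑ x ∈ F, f x := Finset.sum_le_sum fun x hx =>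
      hcS _ (hES (Finset.mem_image_of_mem _ hx))
    have h2 := hc.2 F hFV hFd
    rw [Finset.sum_add_distrib, Finset.sum_const, smul_eq_mul, mul_one] at h1
    omega

end VHypergraph

/-! ### Fixing the value at `x₁`, and the three assertions. -/

section FixedVertex

variable {α : Type*} [DecidableEq α]

theorem mem_vertexCopies {β : Type*} {x : β} {ν : ℕ} {p : β × ℕ} :
    p ∈ vertexCopies x ν ↔ p.1 = x ∧ 1 ≤ p.2 ∧ p.2 ≤ ν := by
  obtain ⟨y, f⟩ := p
  simp only [vertexCopies, List.mem_map, List.mem_range, Prod.mk.injEq]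
  constructor
  · rintro ⟨k, hk, rfl, rfl⟩
    exact ⟨rfl, by omega, by omega⟩
  · rintro ⟨rfl, h1, h2⟩
    exact ⟨f - 1, by omega, rfl, by omega⟩

/-- The independent sets of the expanded complete hypergraph lying over a fixed value `ν` at `x₁`
form a vertex decomposable complex. -/
theorem isVertexDecomposable_of_fixed_value {V : Finset α} {d ℓ ν : ℕ} {x₁ : α} (hd : 2 ≤ d)
    (hν : ν ≤ ℓ) {G : Finset (α × ℕ)} (hG : G ⊆ V ×ˢ Finset.Icc 1 ℓ)
    (hGx : ∀ f, (x₁, f) ∈ G → ν < f)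
    (hfull : ∀ x ∈ V, x ≠ x₁ → ∀ f ∈ Finset.Icc 1 ℓ, (x, f) ∈ G)
    (Δ : SimplComplex (α × ℕ))
    (hΔ : ∀ S, S ∈ Δ.faces ↔ S ⊆ G ∧ ∃ c ∈ coveringFunctions V d ℓ,
      c x₁ ≤ ν ∧ ∀ p ∈ S, c p.1 < p.2) :
    Δ.IsVertexDecomposable := by
  refine isVertexDecomposable_of_isThresholdFace (coveringFunctions V d ℓ) V ℓ
    (fun c hc => hc.1) (fun c hc x hx => update_mem_coveringFunctions hc hx)
    (fun c hc x hx y _ hxy => swap_mem_coveringFunctions hc hx hxy) G (V.erase x₁)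
    (Finset.erase_subset _ _) (fun x => if x = x₁ then ν else 0) ?_ ?_ ?_ Δ (fun S => ?_) ?_
  · rintro ⟨x, f⟩ hp
    simp only
    split_ifs with hx
    · exact hGx f (hx ▸ hp)
    · exact (Finset.mem_Icc.1 (Finset.mem_product.1 (hG hp)).2).1
  · exact fun p hp => (Finset.mem_Icc.1 (Finset.mem_product.1 (hG hp)).2).2
  · intro x hx f hf hfℓ
    obtain ⟨hx₁, hxV⟩ := Finset.mem_erase.1 hx
    rw [if_neg hx₁] at hf
    exact hfull x hxV hx₁ f (Finset.mem_Icc.2 ⟨hf, hfℓ⟩)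
  · rw [hΔ]
    refine and_congr_right fun hSG => ⟨?_, ?_⟩
    · rintro ⟨c, hc, hcx, hcS⟩
      -- Raising `c x₁` to exactly `ν` is harmless, as all copies of `x₁` in `G` lie above `ν`;
      -- values outside `V` play no role and are reset to match the lower bound.
      refine ⟨fun x => if x = x₁ then ν else if x ∈ V then c x else 0,
        mem_coveringFunctions_of_le hc (fun x hx => ?_) (fun x => ?_), fun x hx => ?_,
        fun x => ?_, ?_⟩
      · split_ifs with h
        · exact h ▸ hcx
        · exact le_rfl
      · have := hc.1 x
        split_ifs <;> omega
      · by_cases h : x = x₁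
        · simp [h]
        · have hV : x ∉ V := fun hV => hx (Finset.mem_erase.2 ⟨h, hV⟩)
          simp [h, hV]
      · simp only
        split_ifs <;> simp
      · rintro ⟨x, f⟩ hp
        have hxV := (Finset.mem_product.1 (hG (hSG hp))).1
        simp only at hxV ⊢
        split_ifs with h
        · exact hGx f (h ▸ hSG hp)
        · exact hcS _ hp
    · rintro ⟨c, hc, hcU, -, hcS⟩
      exact ⟨c, hc, ((hcU x₁ (by simp)).trans (if_pos rfl)).le, hcS⟩
  -- This is covering because `d ≥ 2` puts a vertex other than `x₁` in every `d`-set.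
  · refine ⟨∅, (hΔ ∅).2 ⟨Finset.empty_subset _, fun x => if x = x₁ then 0 else ℓ,
      ⟨fun x => ?_, fun F hFV hF => ?_⟩, by simp, by simp⟩⟩
    · simp only
      split_ifs <;> simp
    · obtain ⟨y, hyF, hy⟩ := Finset.exists_mem_ne (by omega : 1 < F.card) x₁
      have := Finset.single_le_sum (f := fun x => if x = x₁ then 0 else ℓ)
        (fun _ _ => Nat.zero_le _) hyF
      simpa [hy] using this

namespace VHypergraph

variable {H : VHypergraph α} {V : Finset α} {d ℓ : ℕ}

theorem IsComplete.isVertexDecomposable_contract (h : H.IsComplete V d) (hd : 2 ≤ d)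
    (hdV : d ≤ V.card) {x₁ : α} (hx₁ : x₁ ∈ V) {ν : ℕ} (hν : ν < ℓ) :
    (((H.expand ℓ).deleteList (vertexCopies x₁ ν)).contract
      (x₁, ν + 1)).IsVertexDecomposable := by
  have hxv : (x₁, ν + 1) ∈ ((H.expand ℓ).deleteList (vertexCopies x₁ ν)).verts := by
    rw [mem_verts_deleteList, h.verts_expand (by omega) hdV, mem_vertexCopies]
    simp [hx₁]; omega
  refine isVertexDecomposable_of_fixed_value (V := V) (d := d) (ℓ := ℓ) (ν := ν) (x₁ := x₁) hd
    hν.le (G := (V ×ˢ Finset.Icc 1 ℓ).filter fun p => p.1 = x₁ → ν + 1 < p.2)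
    (Finset.filter_subset _ _) (fun f hf => ?_) (fun x hx hne f hf => ?_) _ fun S => ?_
  · have := (Finset.mem_filter.1 hf).2 rfl
    simp only at this
    omega
  · exact Finset.mem_filter.2 ⟨Finset.mem_product.2 ⟨hx, hf⟩, fun h => absurd h hne⟩
  rw [mem_independenceComplex, isIndependent_contract_iff hxv ?_, isIndependent_deleteList_iff,
    h.isIndependent_expand_iff (by omega) hdV]
  · constructor
    · rintro ⟨hxS, ⟨hSV, c, hc, hcS⟩, hL⟩
      refine ⟨fun p hp => ?_, c, hc, Nat.lt_succ_iff.1 (hcS _ (Finset.mem_insert_self _ _)),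
        fun p hp => hcS p (Finset.mem_insert_of_mem hp)⟩
      have hpV := hSV (Finset.mem_insert_of_mem hp)
      refine Finset.mem_filter.2 ⟨hpV, fun hpx => ?_⟩
      have h1 := (Finset.mem_Icc.1 (Finset.mem_product.1 hpV).2).1
      have h2 : ¬ p.2 ≤ ν := fun h =>
        hL p (mem_vertexCopies.2 ⟨hpx, h1, h⟩) (Finset.mem_insert_of_mem hp)
      have h3 : p.2 ≠ ν + 1 := fun h => hxS ((Prod.ext hpx h : p = (x₁, ν + 1)) ▸ hp)
      omega
    · rintro ⟨hSG, c, hc, hcx, hcS⟩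
      have hxS : (x₁, ν + 1) ∉ S := fun h => lt_irrefl _ ((Finset.mem_filter.1 (hSG h)).2 rfl)
      refine ⟨hxS, ⟨Finset.insert_subset ?_ (hSG.trans (Finset.filter_subset _ _)), c, hc, ?_⟩, ?_⟩
      · simp [hx₁]; omega
      · intro p hp
        rcases Finset.mem_insert.1 hp with rfl | hp
        · exact Nat.lt_succ_iff.2 hcx
        · exact hcS p hp
      · intro p hpL hp
        obtain ⟨hpx, -, hpν⟩ := mem_vertexCopies.1 hpL
        rcases Finset.mem_insert.1 hp with rfl | hp
        · simp at hpν
        · have := (Finset.mem_filter.1 (hSG hp)).2 hpx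
          omega
  · intro E hE F hF hFE
    refine Finset.eq_of_subset_of_card_le hFE ?_
    rw [h.card_of_mem_edges_expand (mem_edges_deleteList.1 hE).1,
      h.card_of_mem_edges_expand (mem_edges_deleteList.1 hF).1]

theorem IsComplete.isVertexDecomposable_deleteList (h : H.IsComplete V d) (hd : 2 ≤ d)
    (hdV : d ≤ V.card) (x₁ : α) :
    ((H.expand ℓ).deleteList (vertexCopies x₁ ℓ)).IsVertexDecomposable := by
  refine isVertexDecomposable_of_fixed_value (V := V) (d := d) (ℓ := ℓ) (ν := ℓ) (x₁ := x₁) hd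
    le_rfl (G := (V ×ˢ Finset.Icc 1 ℓ).filter fun p => p.1 ≠ x₁)
    (Finset.filter_subset _ _) (fun f hf => absurd rfl (Finset.mem_filter.1 hf).2)
    (fun x hx hne f hf => Finset.mem_filter.2 ⟨Finset.mem_product.2 ⟨hx, hf⟩, hne⟩) _ fun S => ?_
  rw [mem_independenceComplex, isIndependent_deleteList_iff,
    h.isIndependent_expand_iff (by omega) hdV]
  constructor
  · rintro ⟨⟨hSV, c, hc, hcS⟩, hL⟩
    refine ⟨fun p hp => Finset.mem_filter.2 ⟨hSV hp, fun hpx => ?_⟩, c, hc, hc.1 x₁, hcS⟩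
    have := Finset.mem_Icc.1 (Finset.mem_product.1 (hSV hp)).2
    exact hL p (mem_vertexCopies.2 ⟨hpx, this⟩) hp
  · rintro ⟨hSG, c, hc, -, hcS⟩
    exact ⟨⟨hSG.trans (Finset.filter_subset _ _), c, hc, hcS⟩, fun p hpL hp =>
      (Finset.mem_filter.1 (hSG hp)).2 (mem_vertexCopies.1 hpL).1⟩

end VHypergraph

end FixedVertex

theorem SimplComplex.IsSimplex.isComplete_toHypergraph_skeleton {α : Type*} [DecidableEq α]
    {Γ : SimplComplex α} (hΓ : Γ.IsSimplex) {s : ℕ} (hs : s + 1 ≤ Γ.vertexSet.card) :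
    (Γ.skeleton s).toHypergraph.IsComplete Γ.vertexSet (s + 1) := by
  refine ⟨Finset.Subset.antisymm ?_ fun x hx => ?_, fun F => hΓ.isFacet_skeleton_iff hs⟩
  · exact Finset.biUnion_subset_biUnion_of_subset_left _ (Finset.filter_subset _ _)
  · refine Finset.mem_biUnion.2 ⟨{x}, Finset.mem_filter.2 ⟨hΓ.mem_faces_iff.2 ?_, ?_⟩, ?_⟩ <;>
      simp [hx]

theorem theorem4p3 {α : Type*} [DecidableEq α] (Γ : SimplComplex α) (hΓ : Γ.IsSimplex)
    (x₁ : α) (hx₁ : x₁ ∈ Γ.vertexSet)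
    (s : ℕ) (hs : 1 ≤ s) (hsn : s ≤ Γ.vertexSet.card - 1) (ℓ : ℕ) (hℓ : 1 ≤ ℓ) :
    (((Γ.skeleton s).toHypergraph.expand ℓ).contract (x₁, 1)).IsVertexDecomposable ∧
    (∀ ν : ℕ, 1 ≤ ν → ν ≤ ℓ - 1 →
      ((((Γ.skeleton s).toHypergraph.expand ℓ).deleteList
        (vertexCopies x₁ ν)).contract (x₁, ν + 1)).IsVertexDecomposable) ∧
    (((Γ.skeleton s).toHypergraph.expand ℓ).deleteList
      (vertexCopies x₁ ℓ)).IsVertexDecomposable := by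
  have hcard : s + 1 ≤ Γ.vertexSet.card := by
    have := Finset.card_pos.2 ⟨x₁, hx₁⟩
    omega
  have h := hΓ.isComplete_toHypergraph_skeleton hcard
  refine ⟨?_, fun ν _ hν => ?_, ?_⟩
  -- For `ν = 0` the list of deleted copies is empty, so the deletion unfolds to the expansion
  -- itself.
  · exact h.isVertexDecomposable_contract (by omega) hcard hx₁ (ν := 0) (by omega)
  · exact h.isVertexDecomposable_contract (by omega) hcard hx₁ (by omega)
  · exact h.isVertexDecomposable_deleteList (by omega) hcard x₁
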